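/- Let $V$ be a finite set with uniform probability $u\equiv 1/|V|$, let $Q$ be a symmetric Markov kernel on $V$, let $\epsilon\in(0,1)$, $A\subset V$, and let $K=Q+\Delta_A$, where for all $x,y\in V$: $\sum_z\Delta_A(x,z)=0$; $\Delta_A(x,y)\ge-\epsilon Q(x,y)$; and $\Delta_A(x,y)=0$ if $x\notin A$. Let $g$ be a permutation of $V$, put $K_i(x,y)=K(g^{i-1}x,g^{i-1}y)$ for $i\ge 1$, $K_{0,n}=K_1K_2\cdots K_n$ and $\widetilde K(x,y)=K(x,g^{-1}y)$. Let $\widetilde\pi$ be an invariant probability measure for $\widetilde K$ and put $\mu_n(x)=\widetilde\pi(g^nx)$. On $\ell^2(u)$ let $Q$ act by $Qf(x)=\sum_yQ(x,y)f(y)$, with adjoint $Q^*$; let $\sigma_1(Q)$ be its second largest singular value (counted with multiplicity; $\sigma_1(Q)=0$ if $|V|=1$); and let $\mathcal E_{Q^*Q}(f,f)=\langle (I-Q^*Q)f,f\rangle_{\ell^2(u)}$. Assume that there are constants $c,c_1,C_1,D\in(0,\infty)$ and a parameter $T>1$ such that: - $\max_{x\in V}\widetilde\pi(x)\le c\,\min_{x\in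 V}\widetilde\pi(x)$; - $\sigma_1(Q)\le 1-\dfrac{c_1}{T}$; - $Q$ satisfies the Nash inequality (all norms with respect to $u$) $$\forall f:V\to\mathbb R,\qquad \|f\|_2^{2+1/D}\le C_1T\Bigl(\mathcal E_{Q^*Q}(f,f)+\frac1T\|f\|_2^2\Bigr)\|f\|_1^{1/D}.$$ Then, for every integer $n>2T$ and all $x,z\in V$, $$\left|\frac{K_{0,n}(x,z)}{\mu_n(z)}-1\right|\le\left(\frac{16(1+4D)\,C_1\,c^{2+3/(2D)}}{(1-\epsilon)^2}\right)^{2D}\exp\left(-\frac{c_1(1-\epsilon)^2(n-2T)}{c^2T}\right).$$ -/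

import Mathlib

noncomputable section

/-- The uniform probability `u ≡ 1/|V|` on a finite set `V`. -/
def unif (V : Type*) [Fintype V] : V → ℝ := fun _ => 1 / (Fintype.card V : ℝ)

/-- The space `ℓ²(u)` of real functions on the finite set `V`, where `u` is the uniform
probability: the inner product is `⟪f, h⟫ = ∑ x, u x * f x * h x`. -/
def UniformL2 (V : Type*) : Type _ := V → ℝ

namespace UniformL2

variable {V : Type*} [Fintype V]

instance : AddCommGroup (UniformL2 V) := inferInstanceAs (AddCommGroup (V → ℝ))

instance : Module ℝ (UniformL2 V) := inferInstanceAs (Module ℝ (V → ℝ))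

instance : FiniteDimensional ℝ (UniformL2 V) :=
  inferInstanceAs (FiniteDimensional ℝ (V → ℝ))

/-- The inner product of `ℓ²(u)`, with its positivity. -/
abbrev core (V : Type*) [Fintype V] : InnerProductSpace.Core ℝ (UniformL2 V) where
  inner f h := ∑ x, unif V x * f x * h x
  conj_inner_symm f h := by
    simp only [conj_trivial]
    exact Finset.sum_congr rfl fun x _ => by ring
  re_inner_nonneg f := by
    simp only [RCLike.re_to_real]
    refine Finset.sum_nonneg fun x _ => ?_
    have : 0 ≤ unif V x := by unfold unif; positivity
    rw [mul_assoc]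
    exact mul_nonneg this (mul_self_nonneg _)
  add_left f h k := by
    rw [← Finset.sum_add_distrib]
    refine Finset.sum_congr rfl fun x _ => ?_
    change unif V x * (f x + h x) * k x = _
    ring
  smul_left f h r := by
    simp only [conj_trivial, Finset.mul_sum]
    refine Finset.sum_congr rfl fun x _ => ?_
    change unif V x * (r * f x) * h x = _
    ring
  definite f hf := by
    funext x
    have hpos : ∀ y : V, 0 < unif V y := fun y => by
      have : 0 < Fintype.card V := Fintype.card_pos_iff.2 ⟨y⟩
      unfold unif
      positivity
    have h0 := (Finset.sum_eq_zero_iff_of_nonneg (fun y _ => by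
      rw [mul_assoc]
      exact mul_nonneg (hpos y).le (mul_self_nonneg (f y)))).1 hf x (Finset.mem_univ x)
    rw [mul_assoc] at h0
    exact mul_self_eq_zero.1 ((mul_eq_zero.1 h0).resolve_left (hpos x).ne')

instance : NormedAddCommGroup (UniformL2 V) := (core V).toNormedAddCommGroup

instance : InnerProductSpace ℝ (UniformL2 V) := InnerProductSpace.ofCore (core V).toCore

/-- The norm of `ℓ¹(u)`. -/
def norm1 (f : UniformL2 V) : ℝ := ∑ x, unif V x * |f x|

/-- A kernel acting on functions, `(Q f) x = ∑ y, Q x y * f y`, as an operator on `ℓ²(u)`. -/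
def op [DecidableEq V] (Q : Matrix V V ℝ) : UniformL2 V →ₗ[ℝ] UniformL2 V :=
  Matrix.toLin' Q

/-- The Dirichlet form `E_P(f, f) = ⟪(I - P) f, f⟫` of an operator `P` on `ℓ²(u)`. -/
def dirichlet (P : UniformL2 V →ₗ[ℝ] UniformL2 V) (f : UniformL2 V) : ℝ :=
  inner ℝ (f - P f) f

end UniformL2

section Kernels

variable {V : Type*} [Fintype V] [DecidableEq V]

/-- The second largest singular value of the kernel `Q` acting on `ℓ²(u)`. Mathlib numbers the
singular values from `0`, in nonincreasing order with multiplicity. -/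
def sigmaOne (Q : Matrix V V ℝ) : ℝ := (UniformL2.op Q).singularValues 1

/-- The Nash inequality for `Q` on `ℓ²(u)` with constants `C₁`, `D`, `T`. -/
def NashInequality (Q : Matrix V V ℝ) (C₁ D T : ℝ) : Prop :=
  ∀ f : UniformL2 V,
    ‖f‖ ^ (2 + 1 / D) ≤
      C₁ * T *
        (UniformL2.dirichlet (LinearMap.adjoint (UniformL2.op Q) ∘ₗ UniformL2.op Q) f
          + 1 / T * ‖f‖ ^ 2) *
        UniformL2.norm1 f ^ (1 / D)

/-- `Δ` is a perturbation of the kernel `Q`, of relative size at most `ε`, supported by the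
rows in `A`. -/
structure IsPerturbation (ε : ℝ) (A : Set V) (Q Δ : Matrix V V ℝ) : Prop where
  sum_eq_zero : ∀ x, ∑ z, Δ x z = 0
  lower : ∀ x y, -ε * Q x y ≤ Δ x y
  support : ∀ x, x ∉ A → ∀ y, Δ x y = 0

/-- The kernels `K_i(x, y) = K(g^{i-1} x, g^{i-1} y)`, for `i = 1, 2, …`. -/
def waveKernel (g : Equiv.Perm V) (K : Matrix V V ℝ) (i : ℕ) : Matrix V V ℝ :=
  fun x y => K ((g ^ (i - 1)) x) ((g ^ (i - 1)) y)

/-- The `n`-step kernel `K_{0,n} = K_1 K_2 ⋯ K_n` of the time inhomogeneous chain driven by the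
sequence `K_1, K_2, …`. -/
def chainKernel (Ks : ℕ → Matrix V V ℝ) : ℕ → Matrix V V ℝ
  | 0 => 1
  | n + 1 => chainKernel Ks n * Ks (n + 1)

/-- The kernel `K̃(x, y) = K(x, g⁻¹ y)`. -/
def shiftKernel (g : Equiv.Perm V) (K : Matrix V V ℝ) : Matrix V V ℝ :=
  fun x y => K x (g⁻¹ y)

/-- `p` is an invariant probability measure for the kernel `P`. -/
structure IsInvariantProb (P : Matrix V V ℝ) (p : V → ℝ) : Prop where
  nonneg : ∀ x, 0 ≤ p x
  sum_eq_one : ∑ x, p x = 1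
  invariant : ∀ y, ∑ x, p x * P x y = p y

/-- The wave `μ_n(x) = p(g^n x)`. -/
def waveMeasure (g : Equiv.Perm V) (p : V → ℝ) (n : ℕ) : V → ℝ :=
  fun x => p ((g ^ n) x)

end Kernels

end

/-!
The change of variables `y ↦ g ^ i y` at time `i` turns the wave chain into a homogeneous one:
`K_{0,n}(x, z) = P ^ n (x, g ^ n z)` with `P = shiftKernel g K`, while `μ_n(z) = π(g ^ n z)` for the
invariant measure `π` of `P` (`chainKernel_waveKernel_apply`). It remains to show that
`P ^ n (x, w) / π(w)` is close to one.

Both `P` and its time reversal `R` in `ℓ²(π)` satisfy `π(x) P(x, y) ≥ m (1 - ε) Q(a x, b y)` for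
suitable permutations `a`, `b`, where `m = min π`; for `R` this uses the symmetry of `Q`. The form
`‖f‖² - ‖P f‖²` is an average of variances, each of which is a minimum of quadratic errors, so it
dominates `m (1 - ε) |V|` times the Dirichlet form of `Q* Q` at a rearrangement of `f`
(`dirichlet_comparison`). As `π` is within a factor `c` of being uniform, the Nash inequality of `Q`
gives Nash inequalities for `P` and `R` (`nash_transfer`), and its gap `1 - (1 - s)²`, `s = c₁ / T`,
gives the gap `κ (1 - (1 - s)²)` with `κ = (1 - ε) / c` for `P` (`gap_transfer`). The latter makes `P`
contract mean zero functions by `exp (-κ² s)` (`one_sub_mul_le_exp`).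

Iterating the Nash inequalities over `N = ⌊T⌋` steps bounds `P ^ N` and `R ^ N` from `ℓ¹(π)` to
`ℓ²(π)` (`sum_mul_pow_mulVec_sq_rpow_le`). Finally `P ^ n (x, w) / π(w) - 1` is the pairing of
`R ^ N` at a normalised point mass at `x` with `P ^ (n - 2N)` at the centred `P ^ N` of one at `w`,
so that the two Nash bounds and the contraction over `n - 2N ≥ n - 2T` steps multiply up
(`abs_pow_div_sub_one_le`).
-/

/-! ### Two scalar estimates -/

/-- The conversion of the transferred gap into an exponential rate. The right side is bounded below
through `exp (-y) ≥ (1 - y / 4) ^ 4`; after division by `κ s` the difference of the two sides is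
concave in `s`, so that it suffices to look at `s = 0` and `s = 1`. -/
theorem one_sub_mul_le_exp {κ s : ℝ} (hκ0 : 0 ≤ κ) (hκ1 : κ ≤ 1) (hs0 : 0 ≤ s) (hs1 : s ≤ 1) :
    1 - κ * (1 - (1 - s) ^ 2) ≤ Real.exp (-(2 * κ ^ 2 * s)) := by
  have hκ2 : κ ^ 2 ≤ 1 := pow_le_one₀ hκ0 hκ1
  have hw : κ ^ 2 * s ≤ 1 := mul_le_one₀ hκ2 hs0 hs1
  have hend : 0 ≤ 1 - 2 * κ + 3 / 2 * κ ^ 3 - 1 / 2 * κ ^ 5 + 1 / 16 * κ ^ 7 := by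
    -- the minimum, about `0.017`, is attained near `κ = 0.805`
    nlinarith [mul_nonneg hκ0 (sq_nonneg (κ ^ 3 - 0.52)), mul_nonneg hκ0 (sq_nonneg (κ ^ 2 - 0.648)),
      sq_nonneg (κ - 0.805), sq_nonneg (κ ^ 2 - 0.648), mul_nonneg hκ0 (sq_nonneg (κ - 0.805)),
      mul_nonneg (mul_nonneg hκ0 (sub_nonneg.2 hκ1)) (sq_nonneg (κ ^ 2 - 0.648)),
      sq_nonneg (κ * (κ - 0.805)), mul_nonneg hκ0 (sq_nonneg (κ * (κ ^ 2 - 0.648)))]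
  have hconc : 0 ≤ κ ^ 5 * s * (1 - s) * (1 / 2 - κ ^ 2 * (1 + s) / 16) := by
    refine mul_nonneg (mul_nonneg (by positivity) (by linarith)) ?_
    nlinarith [mul_nonneg (sq_nonneg κ) hs0]
  have hpoly : 1 - κ * (1 - (1 - s) ^ 2) ≤ (1 - κ ^ 2 * s / 2) ^ 4 := by
    have h1 : 0 ≤ (1 - s) * (2 * (1 - κ)) := mul_nonneg (by linarith) (by linarith)
    have h2 := mul_nonneg hs0 hend
    have h3 := mul_nonneg (mul_nonneg hκ0 hs0) (add_nonneg (add_nonneg h1 h2) hconc)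
    have h4 : (1 - κ ^ 2 * s / 2) ^ 4 - (1 - κ * (1 - (1 - s) ^ 2)) =
        κ * s * ((1 - s) * (2 * (1 - κ)) +
          s * (1 - 2 * κ + 3 / 2 * κ ^ 3 - 1 / 2 * κ ^ 5 + 1 / 16 * κ ^ 7) +
          κ ^ 5 * s * (1 - s) * (1 / 2 - κ ^ 2 * (1 + s) / 16)) := by ring
    linarith
  refine hpoly.trans ?_
  calc (1 - κ ^ 2 * s / 2) ^ 4 ≤ Real.exp (-(κ ^ 2 * s / 2)) ^ 4 :=
        pow_le_pow_left₀ (by linarith) (Real.one_sub_le_exp_neg _) 4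
    _ = Real.exp (-(2 * κ ^ 2 * s)) := by
        rw [← Real.exp_nat_mul]; congr 1; push_cast; ring

/-- A nonincreasing sequence with `t ^ (1 + θ) ≤ C (t - t₊ + t / T)`, where `t₊` is the next term,
decays like `n ^ (-1 / θ)` until `t ^ θ` reaches the level `2 C / T`: above that level,
`t ^ (-θ)` grows by at least `θ / (2 C)` in each step. -/
theorem rpow_le_of_nash_recursion {t : ℕ → ℝ} {C T θ : ℝ} (ht0 : ∀ n, 0 ≤ t n)
    (hanti : Antitone t) (hC : 0 < C) (hT : 0 < T) (hθ : 0 < θ)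
    (hrec : ∀ n, t n ^ (1 + θ) ≤ C * (t n - t (n + 1) + t n / T)) {N : ℕ} (hN : 0 < N) :
    t N ^ θ ≤ max (2 * C / T) (2 * C / (N * θ)) := by
  rw [le_max_iff, or_iff_not_imp_left, not_le]
  intro hbig
  have hbase : 0 < 2 * C / T := by positivity
  have hlow : ∀ n ≤ N, 2 * C / T < t n ^ θ := fun n hn =>
    hbig.trans_le (Real.rpow_le_rpow (ht0 N) (hanti hn) hθ.le)
  have hpos : ∀ n ≤ N, 0 < t n := fun n hn => by
    refine (ht0 n).lt_of_ne fun h => ?_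
    have := hlow n hn
    rw [← h, Real.zero_rpow hθ.ne'] at this
    linarith
  have key : ∀ n ≤ N, n * (θ / (2 * C)) ≤ (t n ^ θ)⁻¹ := by
    intro n
    induction n with
    | zero => intro _; simpa using Real.rpow_nonneg (ht0 0) θ
    | succ n ih =>
      intro hn
      have hn' : n ≤ N := by omega
      have ih := ih hn'
      have hp := hpos n hn'
      have hp' := hpos (n + 1) hn
      set r := t n ^ θ with hr
      have hr0 : 0 < r := Real.rpow_pos_of_pos hp θ
      -- above the level `2C/T` the term `t/T` costs at most half of the decrease
      have hstep : t (n + 1) ≤ t n * Real.exp (-(r / (2 * C))) := by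
        have h1 := hrec n
        rw [Real.rpow_add hp, Real.rpow_one, ← hr] at h1
        have h2 : t n / T ≤ t n * (r / (2 * C)) := by
          have := hlow n hn'
          rw [div_lt_iff₀ hT] at this
          rw [div_le_iff₀ hT, mul_assoc]
          refine le_mul_of_one_le_right hp.le ?_
          rw [div_mul_eq_mul_div, one_le_div (by positivity)]
          exact this.le
        have h3 : t n * r / C ≤ t n - t (n + 1) + t n / T := by
          rw [div_le_iff₀ hC]; linarith
        have h4 : t (n + 1) ≤ t n * (1 - r / (2 * C)) := by
          have : t n * r / C = 2 * (t n * (r / (2 * C))) := by field_simp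
          linarith
        exact h4.trans (mul_le_mul_of_nonneg_left (Real.one_sub_le_exp_neg _) hp.le)
      have hpow : t (n + 1) ^ θ ≤ r * Real.exp (-(θ * (r / (2 * C)))) := by
        refine (Real.rpow_le_rpow hp'.le hstep hθ.le).trans_eq ?_
        rw [Real.mul_rpow hp.le (Real.exp_pos _).le, ← Real.exp_mul]
        congr 2; ring
      have hr'0 : 0 < t (n + 1) ^ θ := Real.rpow_pos_of_pos hp' θ
      calc ((n + 1 : ℕ) : ℝ) * (θ / (2 * C)) = n * (θ / (2 * C)) + θ / (2 * C) := by
            push_cast; ring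
        _ ≤ r⁻¹ + θ / (2 * C) := by linarith
        _ = r⁻¹ * (θ * (r / (2 * C)) + 1) := by field_simp; ring
        _ ≤ r⁻¹ * Real.exp (θ * (r / (2 * C))) :=
            mul_le_mul_of_nonneg_left (Real.add_one_le_exp _) (inv_pos.2 hr0).le
        _ = (r * Real.exp (-(θ * (r / (2 * C)))))⁻¹ := by
            rw [mul_inv, ← Real.exp_neg, neg_neg]
        _ ≤ (t (n + 1) ^ θ)⁻¹ := inv_anti₀ hr'0 hpow
  have hfin := key N le_rfl
  have hN' : (0 : ℝ) < N := by exact_mod_cast hN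
  have hq : 0 < N * (θ / (2 * C)) := by positivity
  calc t N ^ θ ≤ (N * (θ / (2 * C)))⁻¹ :=
        (le_inv_comm₀ hq (Real.rpow_pos_of_pos (hpos N le_rfl) θ)).1 hfin
    _ = 2 * C / (N * θ) := by field_simp

/-! ### The uniform space -/

section Uniform

variable {V : Type*} [Fintype V]

theorem UniformL2.norm_sq_eq (f : UniformL2 V) :
    ‖f‖ ^ 2 = (∑ x, f x ^ 2) / Fintype.card V := by
  rw [← real_inner_self_eq_norm_sq]
  change ∑ x, unif V x * f x * f x = _
  rw [Finset.sum_div]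
  exact Finset.sum_congr rfl fun x _ => by rw [unif]; ring

theorem UniformL2.dirichlet_adjoint_comp_op [DecidableEq V] (Q : Matrix V V ℝ)
    (f : UniformL2 V) :
    UniformL2.dirichlet (LinearMap.adjoint (UniformL2.op Q) ∘ₗ UniformL2.op Q) f =
      ‖f‖ ^ 2 - ‖UniformL2.op Q f‖ ^ 2 := by
  rw [UniformL2.dirichlet, inner_sub_left, LinearMap.comp_apply, LinearMap.adjoint_inner_left,
    real_inner_self_eq_norm_sq, real_inner_self_eq_norm_sq]

/-- The Nash inequality in terms of sums, with the exponents written through `1 / (2 D)`. -/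
theorem NashInequality.sum_rpow_le [DecidableEq V] {Q : Matrix V V ℝ} {C₁ D T : ℝ}
    (h : NashInequality Q C₁ D T) (f : UniformL2 V) :
    ((∑ x, f x ^ 2) / Fintype.card V) ^ (1 + 1 / (2 * D)) ≤
      C₁ * T * ((∑ x, f x ^ 2) / Fintype.card V - (∑ x, Q.mulVec f x ^ 2) / Fintype.card V +
        (∑ x, f x ^ 2) / Fintype.card V / T) *
        ((∑ x, |f x|) / Fintype.card V) ^ (2 * (1 / (2 * D))) := by
  have h := h f
  rw [UniformL2.dirichlet_adjoint_comp_op, UniformL2.norm_sq_eq, UniformL2.norm_sq_eq] at h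
  have e1 : ‖f‖ ^ (2 + 1 / D) =
      ((∑ x, f x ^ 2) / Fintype.card V) ^ (1 + 1 / (2 * D)) := by
    rw [← UniformL2.norm_sq_eq f, ← Real.rpow_natCast, ← Real.rpow_mul (norm_nonneg _)]
    congr 1
    push_cast
    rw [mul_add, one_div, one_div, mul_inv]
    ring
  have e2 : UniformL2.norm1 f = (∑ x, |f x|) / Fintype.card V := by
    rw [UniformL2.norm1, Finset.sum_div]
    exact Finset.sum_congr rfl fun x _ => by rw [unif]; ring
  have e3 : 2 * (1 / (2 * D)) = 1 / D := by rw [one_div, one_div, mul_inv]; ring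
  rw [e1, e2] at h
  rw [e3]
  refine h.trans_eq ?_
  congr 3
  ring

/-- Below `1`, the second singular value of a symmetric Markov kernel bounds its norm on functions
of mean zero. -/
theorem sum_mulVec_sq_le_of_sigmaOne_lt_one [DecidableEq V] [Nonempty V] {Q : Matrix V V ℝ}
    (hQ : Q ∈ Matrix.rowStochastic ℝ V) (hsymm : Q.IsSymm) {σ : ℝ} (hσ : sigmaOne Q ≤ σ)
    (hσ1 : σ < 1) {f : V → ℝ} (hf : ∑ x, f x = 0) :
    ∑ x, Q.mulVec f x ^ 2 ≤ σ ^ 2 * ∑ x, f x ^ 2 := by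
  have hσ0 : 0 ≤ sigmaOne Q := (UniformL2.op Q).singularValues_nonneg 1
  have hcard : (0 : ℝ) < Fintype.card V := by exact_mod_cast Fintype.card_pos
  set L := UniformL2.op Q with hL
  set S := LinearMap.adjoint L ∘ₗ L with hS
  have hSs : S.IsSymmetric := L.isSymmetric_adjoint_comp_self
  let F : UniformL2 V := f
  let one : UniformL2 V := fun _ => 1
  have hfin : Module.finrank ℝ (UniformL2 V) = Fintype.card V :=
    Module.finrank_fintype_fun_eq_card ℝ
  let e := hSs.eigenvectorBasis hfin
  let l := hSs.eigenvalues hfin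
  have hl : ∀ i, S (e i) = l i • e i := hSs.apply_eigenvectorBasis hfin
  have hLone : L one = one := by
    have := (Matrix.mem_rowStochastic.1 hQ).2
    exact this
  have hadj : LinearMap.adjoint L = L := by
    refine (LinearMap.eq_adjoint_iff L L).2 ?_ |>.symm
    intro a b
    change ∑ x, unif V x * Q.mulVec a x * b x = ∑ x, unif V x * a x * Q.mulVec b x
    simp only [Matrix.mulVec, dotProduct, Finset.mul_sum, Finset.sum_mul, unif]
    rw [Finset.sum_comm]
    refine Finset.sum_congr rfl fun x _ => Finset.sum_congr rfl fun y _ => ?_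
    rw [hsymm.apply x y]; ring
  have hSone : S one = one := by
    rw [hS, LinearMap.comp_apply, hadj, hLone, hLone]
  have h1F : inner ℝ one F = 0 := by
    change ∑ x, unif V x * 1 * f x = 0
    simp only [unif, mul_one, ← Finset.mul_sum, hf, mul_zero]
  have h1ne : one ≠ 0 := fun h => by
    have := congrFun h (Classical.arbitrary V)
    exact one_ne_zero this
  -- the eigenvalues other than the top one are at most `σ₁²`
  have hsmall : ∀ i : Fin (Fintype.card V), i.val ≠ 0 → l i ≤ sigmaOne Q ^ 2 := by
    intro i hi
    have h1 : 1 < Fintype.card V := by omega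
    rw [sigmaOne, LinearMap.sq_singularValues_of_lt _ hfin h1]
    exact hSs.eigenvalues_antitone hfin (Fin.mk_le_of_le_val (by omega))
  have hsq : sigmaOne Q ^ 2 < 1 := by nlinarith
  have horth : ∀ i : Fin (Fintype.card V), i.val ≠ 0 → inner ℝ (e i) one = 0 := by
    intro i hi
    have h1 := hSs (e i) one
    rw [hl, hSone, real_inner_smul_left] at h1
    have h2 := hsmall i hi
    have : (l i - 1) * inner ℝ (e i) one = 0 := by linarith
    exact (mul_eq_zero.1 this).resolve_left (by linarith)
  -- so the constants span the top eigenline, and `f` has no component along it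
  have hF0 : ∀ i : Fin (Fintype.card V), i.val = 0 → inner ℝ (e i) F = 0 := by
    intro i hi
    have hexp : one = inner ℝ (e i) one • e i := by
      conv_lhs => rw [← e.sum_repr' one]
      refine Finset.sum_eq_single i (fun j _ hj => ?_) (by simp)
      rw [horth j fun h => hj (Fin.ext (by omega)), zero_smul]
    have hne : inner ℝ (e i) one ≠ (0 : ℝ) := fun h => by
      rw [h, zero_smul] at hexp; exact h1ne hexp
    rw [hexp, real_inner_smul_left] at h1F
    exact (mul_eq_zero.1 h1F).resolve_left hne
  have hLF : ‖L F‖ ^ 2 = ∑ i, l i * inner ℝ (e i) F ^ 2 := by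
    rw [← real_inner_self_eq_norm_sq, ← LinearMap.adjoint_inner_right]
    change inner ℝ F (S F) = _
    rw [← e.sum_inner_mul_inner F (S F)]
    refine Finset.sum_congr rfl fun i _ => ?_
    rw [← hSs (e i) F, hl, real_inner_smul_left, real_inner_comm]
    ring
  have hFF : ‖F‖ ^ 2 = ∑ i, inner ℝ (e i) F ^ 2 := by
    rw [← real_inner_self_eq_norm_sq, ← e.sum_inner_mul_inner F F]
    refine Finset.sum_congr rfl fun i _ => ?_
    rw [real_inner_comm]
    ring
  have hle : ‖L F‖ ^ 2 ≤ σ ^ 2 * ‖F‖ ^ 2 := by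
    rw [hLF, hFF, Finset.mul_sum]
    refine Finset.sum_le_sum fun i _ => ?_
    by_cases hi : i.val = 0
    · rw [hF0 i hi]; simp
    · refine mul_le_mul_of_nonneg_right ((hsmall i hi).trans ?_) (sq_nonneg _)
      exact pow_le_pow_left₀ hσ0 hσ 2
  rw [UniformL2.norm_sq_eq, UniformL2.norm_sq_eq, ← mul_div_assoc,
    div_le_div_iff_of_pos_right hcard] at hle
  exact hle

end Uniform

/-! ### Weighted quadratic forms of a Markov kernel -/

section Weighted

variable {V : Type*} [Fintype V]

theorem sum_mul_mulVec {P : Matrix V V ℝ} {π : V → ℝ} (hinv : ∀ y, ∑ x, π x * P x y = π y)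
    (f : V → ℝ) : ∑ x, π x * P.mulVec f x = ∑ x, π x * f x := by
  simp only [Matrix.mulVec, dotProduct, Finset.mul_sum]
  rw [Finset.sum_comm]
  refine Finset.sum_congr rfl fun y _ => ?_
  rw [← hinv y, Finset.sum_mul]
  exact Finset.sum_congr rfl fun x _ => by ring

/-- The Dirichlet form of `P* P` on `ℓ²(π)` is the mean of the variances under the `P x ·`. -/
theorem sum_mul_sq_sub_sum_mul_mulVec_sq {P : Matrix V V ℝ} {π : V → ℝ}
    (hrow : ∀ x, ∑ y, P x y = 1) (hinv : ∀ y, ∑ x, π x * P x y = π y) (f : V → ℝ) :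
    ∑ x, π x * f x ^ 2 - ∑ x, π x * P.mulVec f x ^ 2 =
      ∑ x, ∑ y, π x * P x y * (f y - P.mulVec f x) ^ 2 := by
  rw [← sum_mul_mulVec hinv (fun x => f x ^ 2), ← Finset.sum_sub_distrib]
  refine Finset.sum_congr rfl fun x _ => ?_
  have h1 : ∑ y, P x y * f y = P.mulVec f x := rfl
  have h2 : ∑ y, P x y * f y ^ 2 = P.mulVec (fun x => f x ^ 2) x := rfl
  have h3 : ∀ y, π x * P x y * (f y - P.mulVec f x) ^ 2 = π x * (P x y * f y ^ 2) -
      2 * π x * P.mulVec f x * (P x y * f y) + π x * P.mulVec f x ^ 2 * P x y := fun y => by ring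
  simp only [h3, Finset.sum_add_distrib, Finset.sum_sub_distrib, ← Finset.mul_sum, h1, h2, hrow]
  ring

theorem sum_mul_mulVec_sq_le {P : Matrix V V ℝ} {π : V → ℝ} (hπ : ∀ x, 0 ≤ π x)
    (hP : ∀ x y, 0 ≤ P x y) (hrow : ∀ x, ∑ y, P x y = 1)
    (hinv : ∀ y, ∑ x, π x * P x y = π y) (f : V → ℝ) :
    ∑ x, π x * P.mulVec f x ^ 2 ≤ ∑ x, π x * f x ^ 2 := by
  rw [← sub_nonneg, sum_mul_sq_sub_sum_mul_mulVec_sq hrow hinv]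
  exact Finset.sum_nonneg fun x _ => Finset.sum_nonneg fun y _ =>
    mul_nonneg (mul_nonneg (hπ x) (hP x y)) (sq_nonneg _)

theorem sum_mul_abs_mulVec_le {P : Matrix V V ℝ} {π : V → ℝ} (hπ : ∀ x, 0 ≤ π x)
    (hP : ∀ x y, 0 ≤ P x y) (hinv : ∀ y, ∑ x, π x * P x y = π y) (f : V → ℝ) :
    ∑ x, π x * |P.mulVec f x| ≤ ∑ x, π x * |f x| := by
  rw [← sum_mul_mulVec hinv (fun x => |f x|)]
  refine Finset.sum_le_sum fun x _ => mul_le_mul_of_nonneg_left ?_ (hπ x)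
  refine (Finset.abs_sum_le_sum_abs _ _).trans_eq (Finset.sum_congr rfl fun y _ => ?_)
  rw [abs_mul, abs_of_nonneg (hP x y)]

/-- Comparison of Dirichlet forms. Since a mean minimises the quadratic error, `π x` times the
variance of `f` under `P x ·` dominates `δ` times its variance under any probability `q` with
`δ q ≤ π x • P x ·`; only the first power of the comparison constant is lost. -/
theorem dirichlet_comparison {P Q : Matrix V V ℝ} {π : V → ℝ} {δ : ℝ} (hδ : 0 ≤ δ)
    (hrow : ∀ x, ∑ y, P x y = 1) (hinv : ∀ y, ∑ x, π x * P x y = π y)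
    (hQrow : ∀ x, ∑ y, Q x y = 1) (hQcol : ∀ y, ∑ x, Q x y = 1)
    (a b : Equiv.Perm V) (hPQ : ∀ x y, δ * Q (a x) (b y) ≤ π x * P x y) (f : V → ℝ) :
    δ * (∑ x, f x ^ 2 - ∑ x, Q.mulVec (fun y => f (b.symm y)) x ^ 2) ≤
      ∑ x, π x * f x ^ 2 - ∑ x, π x * P.mulVec f x ^ 2 := by
  rw [sum_mul_sq_sub_sum_mul_mulVec_sq hrow hinv]
  set h : V → ℝ := fun y => f (b.symm y) with hh
  have hsq : ∑ x, f x ^ 2 = ∑ x, 1 * h x ^ 2 := by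
    simp only [one_mul, hh]
    exact (Equiv.sum_comp b.symm fun x => f x ^ 2).symm
  have hinvQ : ∀ y, ∑ x, (1 : V → ℝ) x * Q x y = (1 : V → ℝ) y := fun y => by simp [hQcol]
  have hsum : ∑ x, f x ^ 2 - ∑ x, Q.mulVec h x ^ 2 =
      ∑ x, (∑ y, Q (a x) y * h y ^ 2 - Q.mulVec h (a x) ^ 2) := by
    rw [hsq, Equiv.sum_comp a fun x => ∑ y, Q x y * h y ^ 2 - Q.mulVec h x ^ 2,
      Finset.sum_sub_distrib]
    have := sum_mul_mulVec hinvQ (fun x => h x ^ 2)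
    simp only [Pi.one_apply, one_mul] at this ⊢
    rw [← this]
    rfl
  rw [hsum, Finset.mul_sum]
  refine Finset.sum_le_sum fun x _ => ?_
  set w := P.mulVec f x
  have h1 : ∑ y, Q (a x) y * h y = Q.mulVec h (a x) := rfl
  calc δ * (∑ y, Q (a x) y * h y ^ 2 - Q.mulVec h (a x) ^ 2)
      ≤ δ * ∑ y, Q (a x) y * (h y - w) ^ 2 := by
        refine mul_le_mul_of_nonneg_left ?_ hδ
        have h3 : ∀ y, Q (a x) y * (h y - w) ^ 2 = Q (a x) y * h y ^ 2 -
          2 * w * (Q (a x) y * h y) + w ^ 2 * Q (a x) y := fun y => by ring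
        simp only [h3, Finset.sum_add_distrib, Finset.sum_sub_distrib, ← Finset.mul_sum, h1, hQrow]
        nlinarith [sq_nonneg (Q.mulVec h (a x) - w)]
    _ = ∑ y, δ * Q (a x) (b y) * (f y - w) ^ 2 := by
        rw [← Equiv.sum_comp b, Finset.mul_sum]
        refine Finset.sum_congr rfl fun y _ => ?_
        simp only [hh, Equiv.symm_apply_apply]
        ring
    _ ≤ ∑ y, π x * P x y * (f y - w) ^ 2 :=
        Finset.sum_le_sum fun y _ => mul_le_mul_of_nonneg_right (hPQ x y) (sq_nonneg _)

/-- Iterating a Nash inequality: a function of `ℓ¹(π)`-norm at most one has an `ℓ²(π)`-norm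
controlled by the Nash constants after `N` steps, because `P` contracts both norms. -/
theorem sum_mul_pow_mulVec_sq_rpow_le [DecidableEq V] {P : Matrix V V ℝ} {π : V → ℝ} {C T θ : ℝ}
    (hπ : ∀ x, 0 ≤ π x) (hP : ∀ x y, 0 ≤ P x y) (hrow : ∀ x, ∑ y, P x y = 1)
    (hinv : ∀ y, ∑ x, π x * P x y = π y) (hC : 0 < C) (hT : 0 < T) (hθ : 0 < θ)
    (hNash : ∀ f : V → ℝ, (∑ x, π x * f x ^ 2) ^ (1 + θ) ≤
      C * (∑ x, π x * f x ^ 2 - ∑ x, π x * P.mulVec f x ^ 2 + (∑ x, π x * f x ^ 2) / T) *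
        (∑ x, π x * |f x|) ^ (2 * θ))
    {f : V → ℝ} (hf : ∑ x, π x * |f x| ≤ 1) {N : ℕ} (hN : 0 < N) :
    (∑ x, π x * (P ^ N).mulVec f x ^ 2) ^ θ ≤ max (2 * C / T) (2 * C / (N * θ)) := by
  have hsucc : ∀ n, (P ^ (n + 1)).mulVec f = P.mulVec ((P ^ n).mulVec f) := fun n => by
    rw [pow_succ', Matrix.mulVec_mulVec]
  have hanti : Antitone fun n => ∑ x, π x * (P ^ n).mulVec f x ^ 2 :=
    antitone_nat_of_succ_le fun n => by
      simp only [hsucc]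
      exact sum_mul_mulVec_sq_le hπ hP hrow hinv _
  have hL1 : ∀ n, ∑ x, π x * |(P ^ n).mulVec f x| ≤ 1 := fun n => by
    induction n with
    | zero => simpa using hf
    | succ n ih => rw [hsucc]; exact (sum_mul_abs_mulVec_le hπ hP hinv _).trans ih
  have h0 : ∀ n, 0 ≤ ∑ x, π x * (P ^ n).mulVec f x ^ 2 := fun n =>
    Finset.sum_nonneg fun x _ => mul_nonneg (hπ x) (sq_nonneg _)
  refine rpow_le_of_nash_recursion (t := fun n => ∑ x, π x * (P ^ n).mulVec f x ^ 2) h0 hanti hC hT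
    hθ (fun n => ?_) hN
  refine (hNash ((P ^ n).mulVec f)).trans ?_
  rw [← hsucc]
  refine mul_le_of_le_one_right (mul_nonneg hC.le (add_nonneg (sub_nonneg.2 (hanti n.le_succ))
    (div_nonneg (h0 n) hT.le))) (Real.rpow_le_one ?_ (hL1 n) (by positivity))
  exact Finset.sum_nonneg fun x _ => mul_nonneg (hπ x) (abs_nonneg _)

/-- The adjoint of the kernel `P` in `ℓ²(π)`, that is, its time reversal. -/
noncomputable def timeReversal (π : V → ℝ) (P : Matrix V V ℝ) : Matrix V V ℝ :=
  fun x y => π y * P y x / π x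

theorem sum_mul_mulVec_timeReversal {P : Matrix V V ℝ} {π : V → ℝ} (hπ : ∀ x, 0 < π x)
    (f h : V → ℝ) :
    ∑ x, π x * (f x * P.mulVec h x) = ∑ x, π x * ((timeReversal π P).mulVec f x * h x) := by
  simp only [Matrix.mulVec, dotProduct, timeReversal, Finset.mul_sum, Finset.sum_mul]
  rw [Finset.sum_comm]
  refine Finset.sum_congr rfl fun x _ => Finset.sum_congr rfl fun y _ => ?_
  have := (hπ x).ne'
  field_simp

theorem sum_mul_pow_mulVec_timeReversal [DecidableEq V] {P : Matrix V V ℝ} {π : V → ℝ}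
    (hπ : ∀ x, 0 < π x) (n : ℕ) (f h : V → ℝ) :
    ∑ x, π x * (f x * (P ^ n).mulVec h x) =
      ∑ x, π x * ((timeReversal π P ^ n).mulVec f x * h x) := by
  induction n generalizing f h with
  | zero => simp
  | succ n ih =>
    rw [pow_succ', ← Matrix.mulVec_mulVec, sum_mul_mulVec_timeReversal hπ, ih,
      Matrix.mulVec_mulVec, ← pow_succ]

/-- Duality: the density of `P ^ (N + m + N)` at `(x, w)` is the pairing of `P ^ N` applied to
a normalised point mass at `w` with the reversal applied to one at `x`. If both have `ℓ²(π)`-norm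
at most `√B`, and `P` contracts functions of mean zero, the density is close to one. -/
theorem abs_pow_div_sub_one_le [DecidableEq V] {P : Matrix V V ℝ} {π : V → ℝ}
    (hπ : ∀ x, 0 < π x) (hsum : ∑ x, π x = 1) (hrow : ∀ x, ∑ y, P x y = 1)
    (hinv : ∀ y, ∑ x, π x * P x y = π y) {N m : ℕ} {B ρ : ℝ} (hρ : 0 ≤ ρ)
    (hgap : ∀ f : V → ℝ, ∑ x, π x * f x = 0 →
      ∑ x, π x * P.mulVec f x ^ 2 ≤ ρ ^ 2 * ∑ x, π x * f x ^ 2)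
    (hfwd : ∀ f : V → ℝ, ∑ x, π x * |f x| ≤ 1 → ∑ x, π x * (P ^ N).mulVec f x ^ 2 ≤ B)
    (hbwd : ∀ f : V → ℝ, ∑ x, π x * |f x| ≤ 1 →
      ∑ x, π x * (timeReversal π P ^ N).mulVec f x ^ 2 ≤ B) (x w : V) :
    |(P ^ (N + m + N)) x w / π w - 1| ≤ B * ρ ^ m := by
  have hmean : ∀ n (f : V → ℝ), ∑ x, π x * (P ^ n).mulVec f x = ∑ x, π x * f x := by
    intro n f
    induction n with
    | zero => simp
    | succ n ih => rw [pow_succ', ← Matrix.mulVec_mulVec, sum_mul_mulVec hinv, ih]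
  have hone : ∀ n, (P ^ n).mulVec (fun _ => 1) = fun _ => 1 := by
    intro n
    induction n with
    | zero => simp
    | succ n ih =>
      rw [pow_succ, ← Matrix.mulVec_mulVec]
      rw [show P.mulVec (fun _ => 1) = fun _ => 1 from funext fun x => by
        simp [Matrix.mulVec, dotProduct, hrow], ih]
  set bump : V → V → ℝ := fun v => Pi.single v (π v)⁻¹ with hbump
  have hbump1 : ∀ v, ∑ y, π y * bump v y = 1 := fun v => by
    rw [Finset.sum_eq_single v]
    · simp [hbump, (hπ v).ne']
    · intro y _ hy; simp [hbump, hy]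
    · simp
  have hbumpabs : ∀ v, ∑ y, π y * |bump v y| ≤ 1 := fun v => by
    rw [← hbump1 v]
    refine Finset.sum_le_sum fun y _ => mul_le_mul_of_nonneg_left (abs_of_nonneg ?_).le (hπ y).le
    by_cases hy : y = v
    · subst hy; simp [hbump, (hπ y).le]
    · simp [hbump, hy]
  have hB := hfwd _ (hbumpabs w)
  have hB' := hbwd _ (hbumpabs x)
  set F := (P ^ N).mulVec (bump w) with hF
  set G := (timeReversal π P ^ N).mulVec (bump x) with hG
  -- the centred function, on which the spectral gap acts
  set F₀ : V → ℝ := fun y => F y - 1 with hF₀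
  have hFmean : ∑ y, π y * F y = 1 := by rw [hF, hmean, hbump1]
  have hF₀mean : ∑ y, π y * F₀ y = 0 := by
    simp only [hF₀, mul_sub, Finset.sum_sub_distrib, hFmean, mul_one, hsum, sub_self]
  have hF₀sq : ∑ y, π y * F₀ y ^ 2 ≤ B := by
    have : ∀ y, π y * F₀ y ^ 2 = π y * F y ^ 2 - 2 * (π y * F y) + π y := fun y => by
      simp only [hF₀]; ring
    simp only [this, Finset.sum_add_distrib, Finset.sum_sub_distrib, ← Finset.mul_sum, hFmean,
      hsum]
    linarith
  have hdecay : ∀ n, ∑ y, π y * (P ^ n).mulVec F₀ y ^ 2 ≤ (ρ ^ n) ^ 2 * B := by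
    intro n
    induction n with
    | zero => simpa using hF₀sq
    | succ n ih =>
      rw [pow_succ' P, ← Matrix.mulVec_mulVec]
      refine (hgap _ ((hmean n F₀).trans hF₀mean)).trans ?_
      calc ρ ^ 2 * _ ≤ ρ ^ 2 * ((ρ ^ n) ^ 2 * B) := mul_le_mul_of_nonneg_left ih (sq_nonneg _)
        _ = _ := by ring
  have hpair : (P ^ (N + m + N)) x w / π w - 1 = ∑ y, π y * (G y * (P ^ m).mulVec F₀ y) := by
    rw [hG, ← sum_mul_pow_mulVec_timeReversal hπ, Finset.sum_eq_single x]
    · have hsub : F₀ = F - fun _ => 1 := rfl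
      rw [Matrix.mulVec_mulVec, hsub, Matrix.mulVec_sub, ← pow_add, hone, hF, Matrix.mulVec_mulVec,
        ← pow_add]
      simp [hbump, Matrix.mulVec_single, (hπ x).ne']
      rfl
    · intro y _ hy; simp [hbump, hy]
    · simp
  have hB0 : 0 ≤ B := (Finset.sum_nonneg fun y _ => mul_nonneg (hπ y).le (sq_nonneg _)).trans hB'
  have hcs : (∑ y, π y * (G y * (P ^ m).mulVec F₀ y)) ^ 2 ≤
      (∑ y, π y * G y ^ 2) * ∑ y, π y * (P ^ m).mulVec F₀ y ^ 2 :=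
    Finset.sum_sq_le_sum_mul_sum_of_sq_le_mul _
      (fun y _ => mul_nonneg (hπ y).le (sq_nonneg _))
      (fun y _ => mul_nonneg (hπ y).le (sq_nonneg _)) (fun y _ => le_of_eq (by ring))
  rw [hpair]
  refine abs_le_of_sq_le_sq (hcs.trans ?_) (by positivity)
  calc _ ≤ B * ((ρ ^ m) ^ 2 * B) := mul_le_mul hB' (hdecay m)
        (Finset.sum_nonneg fun y _ => mul_nonneg (hπ y).le (sq_nonneg _)) hB0
    _ = _ := by ring

end Weighted

/-! ### Transfer from the uniform measure to an almost uniform one -/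

section Transfer

variable {V : Type*} [Fintype V]

/-- A Nash inequality for `Q` on `ℓ²(u)` passes to a kernel `P` on `ℓ²(π)` whose Dirichlet form
dominates that of `Q`, at the price of a power of `c`, a bound for the ratio of the extreme values
of `π`. -/
theorem nash_transfer [DecidableEq V] [Nonempty V] {Q P : Matrix V V ℝ} {π : V → ℝ}
    {C₁ D T c η m : ℝ} (hNash : NashInequality Q C₁ D T) (hC₁ : 0 < C₁) (hD : 0 < D)
    (hT : 0 < T) (hc : 0 < c) (hη : 0 < η) (hη1 : η ≤ 1) (hm : 0 < m) (hlow : ∀ x, m ≤ π x)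
    (hup : ∀ x, π x ≤ c * m) (hsum : ∑ x, π x = 1) (hP : ∀ x y, 0 ≤ P x y)
    (hrow : ∀ x, ∑ y, P x y = 1) (hinv : ∀ y, ∑ x, π x * P x y = π y) (b : Equiv.Perm V)
    (hcmp : ∀ f : V → ℝ,
      m * η * (∑ x, f x ^ 2 - ∑ x, Q.mulVec (fun y => f (b.symm y)) x ^ 2) ≤
        ∑ x, π x * f x ^ 2 - ∑ x, π x * P.mulVec f x ^ 2) (f : V → ℝ) :
    (∑ x, π x * f x ^ 2) ^ (1 + 1 / (2 * D)) ≤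
      C₁ * T * c ^ (1 + 2 * (1 / (2 * D))) / η *
        (∑ x, π x * f x ^ 2 - ∑ x, π x * P.mulVec f x ^ 2 + (∑ x, π x * f x ^ 2) / T) *
        (∑ x, π x * |f x|) ^ (2 * (1 / (2 * D))) := by
  have hπ : ∀ x, 0 ≤ π x := fun x => hm.le.trans (hlow x)
  have hN : (0 : ℝ) < Fintype.card V := by exact_mod_cast Fintype.card_pos
  have hθ : 0 < 1 / (2 * D) := by positivity
  have hE0 := sub_nonneg.2 (sum_mul_mulVec_sq_le hπ hP hrow hinv f)
  have hn := hNash.sum_rpow_le fun y => f (b.symm y)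
  have hcmp := hcmp f
  have esq : ∑ y, f (b.symm y) ^ 2 = ∑ x, f x ^ 2 := Equiv.sum_comp b.symm fun x => f x ^ 2
  have eabs : ∑ y, |f (b.symm y)| = ∑ x, |f x| := Equiv.sum_comp b.symm fun x => |f x|
  rw [esq, eabs] at hn
  have hS0 : 0 ≤ ∑ x, π x * f x ^ 2 :=
    Finset.sum_nonneg fun x _ => mul_nonneg (hπ x) (sq_nonneg _)
  have hSlow : m * ∑ x, f x ^ 2 ≤ ∑ x, π x * f x ^ 2 := by
    rw [Finset.mul_sum]
    exact Finset.sum_le_sum fun x _ => mul_le_mul_of_nonneg_right (hlow x) (sq_nonneg _)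
  have hSup : ∑ x, π x * f x ^ 2 ≤ c * m * ∑ x, f x ^ 2 := by
    rw [Finset.mul_sum]
    exact Finset.sum_le_sum fun x _ => mul_le_mul_of_nonneg_right (hup x) (sq_nonneg _)
  have hLlow : m * ∑ x, |f x| ≤ ∑ x, π x * |f x| := by
    rw [Finset.mul_sum]
    exact Finset.sum_le_sum fun x _ => mul_le_mul_of_nonneg_right (hlow x) (abs_nonneg _)
  have hcα : 1 ≤ c * (m * Fintype.card V) := by
    calc (1 : ℝ) = ∑ x, π x := hsum.symm
      _ ≤ ∑ _x : V, c * m := Finset.sum_le_sum fun x _ => hup x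
      _ = c * (m * Fintype.card V) := by
          rw [Finset.sum_const, Finset.card_univ, nsmul_eq_mul]; ring
  have hX0 : 0 ≤ (∑ x, f x ^ 2) / Fintype.card V :=
    div_nonneg (Finset.sum_nonneg fun x _ => sq_nonneg _) hN.le
  have hL0 : 0 ≤ (∑ x, |f x|) / Fintype.card V :=
    div_nonneg (Finset.sum_nonneg fun x _ => abs_nonneg _) hN.le
  set θ := 1 / (2 * D)
  set E := ∑ x, π x * f x ^ 2 - ∑ x, π x * P.mulVec f x ^ 2
  set S := ∑ x, π x * f x ^ 2
  set L := ∑ x, π x * |f x|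
  set X := (∑ x, f x ^ 2) / Fintype.card V with hX
  set Y := (∑ x, Q.mulVec (fun y => f (b.symm y)) x ^ 2) / Fintype.card V with hY
  set l := (∑ x, |f x|) / Fintype.card V with hl
  set α := m * Fintype.card V with hα
  have hα0 : 0 < α := mul_pos hm hN
  have hX' : ∑ x, f x ^ 2 = X * Fintype.card V := by rw [hX]; field_simp
  have hY' : ∑ x, Q.mulVec (fun y => f (b.symm y)) x ^ 2 = Y * Fintype.card V := by
    rw [hY]; field_simp
  have hl' : ∑ x, |f x| = l * Fintype.card V := by rw [hl]; field_simp
  rw [hX'] at hSlow hSup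
  rw [hX', hY'] at hcmp
  rw [hl'] at hLlow
  have hform : X - Y + X / T ≤ (E + S / T) / (η * α) := by
    rw [le_div_iff₀ (by positivity)]
    have h1 : (X - Y) * (η * α) ≤ E := by
      refine le_trans (le_of_eq ?_) hcmp
      rw [hα]; ring
    have h2 : X * (η * α) ≤ S := by
      refine le_trans ?_ hSlow
      have : η * (X * α) ≤ 1 * (X * α) := mul_le_mul_of_nonneg_right hη1 (by positivity)
      linarith [hα ▸ this, show X * (η * α) = η * (X * α) by ring,
        show m * (X * Fintype.card V) = 1 * (X * α) by rw [hα]; ring]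
    have h3 : X / T * (η * α) ≤ S / T := by
      rw [div_mul_eq_mul_div]; exact div_le_div_of_nonneg_right h2 hT.le
    linarith
  have hnorm : l ^ (2 * θ) ≤ L ^ (2 * θ) / α ^ (2 * θ) := by
    have hlL : l ≤ L / α := by
      rw [le_div_iff₀ hα0]
      refine le_trans (le_of_eq ?_) hLlow
      rw [hα]; ring
    have hL' : 0 ≤ L := by
      have := hL0.trans hlL
      rwa [le_div_iff₀ hα0, zero_mul] at this
    rw [← Real.div_rpow hL' hα0.le]
    exact Real.rpow_le_rpow hL0 hlL (by positivity)
  have hEST : 0 ≤ E + S / T := add_nonneg hE0 (div_nonneg hS0 hT.le)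
  have hcα0 : 0 < c * α := mul_pos hc hα0
  -- the exponent of `c α ≥ 1` is raised so that the powers of `α` cancel
  calc S ^ (1 + θ) ≤ (c * α * X) ^ (1 + θ) := by
        refine Real.rpow_le_rpow hS0 (hSup.trans_eq ?_) (by positivity)
        rw [hα]; ring
    _ = (c * α) ^ (1 + θ) * X ^ (1 + θ) := Real.mul_rpow hcα0.le hX0
    _ ≤ (c * α) ^ (1 + 2 * θ) * (C₁ * T * ((E + S / T) / (η * α)) *
          (L ^ (2 * θ) / α ^ (2 * θ))) := by
        refine mul_le_mul (Real.rpow_le_rpow_of_exponent_le hcα (by linarith)) (hn.trans ?_)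
          (Real.rpow_nonneg hX0 _) (Real.rpow_nonneg hcα0.le _)
        refine mul_le_mul (mul_le_mul_of_nonneg_left hform (by positivity)) hnorm
          (Real.rpow_nonneg hL0 _) (by positivity)
    _ = C₁ * T * c ^ (1 + 2 * θ) / η * (E + S / T) * L ^ (2 * θ) := by
        rw [Real.mul_rpow hc.le hα0.le, Real.rpow_add hα0, Real.rpow_one]
        have : α ^ (2 * θ) ≠ 0 := (Real.rpow_pos_of_pos hα0 _).ne'
        field_simp

/-- A gap `lam` for the kernel `Q` on `ℓ²(u)` passes to a kernel `P` on `ℓ²(π)` whose Dirichlet form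
dominates that of `Q`, at the price of the factor `κ`. -/
theorem gap_transfer {Q P : Matrix V V ℝ} {π : V → ℝ} {lam δ M κ : ℝ} [Nonempty V]
    (hQgap : ∀ f : V → ℝ, ∑ x, f x = 0 →
      ∑ x, Q.mulVec f x ^ 2 ≤ (1 - lam) * ∑ x, f x ^ 2)
    (hlam : 0 ≤ lam) (hδ : 0 ≤ δ) (hκ : 0 ≤ κ) (hκM : κ * M ≤ δ) (hup : ∀ x, π x ≤ M)
    (hsum : ∑ x, π x = 1) (hrow : ∀ x, ∑ y, P x y = 1)
    (hinv : ∀ y, ∑ x, π x * P x y = π y) (b : Equiv.Perm V)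
    (hcmp : ∀ f : V → ℝ,
      δ * (∑ x, f x ^ 2 - ∑ x, Q.mulVec (fun y => f (b.symm y)) x ^ 2) ≤
        ∑ x, π x * f x ^ 2 - ∑ x, π x * P.mulVec f x ^ 2)
    {f : V → ℝ} (hf : ∑ x, π x * f x = 0) :
    ∑ x, π x * P.mulVec f x ^ 2 ≤ (1 - κ * lam) * ∑ x, π x * f x ^ 2 := by
  have hN : (Fintype.card V : ℝ) ≠ 0 := by exact_mod_cast Fintype.card_ne_zero
  -- `f` is centred for `π`; the gap of `Q` applies once it is centred for `u`
  set a := (∑ x, f x) / Fintype.card V with ha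
  set h : V → ℝ := fun x => f x - a with hh
  have hmean : ∑ y, h (b.symm y) = 0 := by
    rw [Equiv.sum_comp b.symm h]
    simp only [hh, Finset.sum_sub_distrib, Finset.sum_const, Finset.card_univ, nsmul_eq_mul, ha]
    field_simp
    ring
  have hPh : ∀ x, P.mulVec h x = P.mulVec f x - a := fun x => by
    simp only [hh, Matrix.mulVec, dotProduct, mul_sub, Finset.sum_sub_distrib, ← Finset.sum_mul,
      hrow, one_mul]
  have hexp : ∀ k : V → ℝ, ∑ x, π x * k x = 0 →
      ∑ x, π x * (k x - a) ^ 2 = ∑ x, π x * k x ^ 2 + a ^ 2 := fun k hk => by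
    have : ∀ x, π x * (k x - a) ^ 2 = π x * k x ^ 2 - 2 * a * (π x * k x) + a ^ 2 * π x :=
      fun x => by ring
    simp only [this, Finset.sum_add_distrib, Finset.sum_sub_distrib, ← Finset.mul_sum, hk, hsum]
    ring
  have h1 := hcmp h
  have h2 := hQgap _ hmean
  rw [Equiv.sum_comp b.symm fun x => h x ^ 2] at h2
  have h3 : ∑ x, π x * h x ^ 2 ≤ M * ∑ x, h x ^ 2 := by
    rw [Finset.mul_sum]
    exact Finset.sum_le_sum fun x _ => mul_le_mul_of_nonneg_right (hup x) (sq_nonneg _)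
  have hsq : 0 ≤ ∑ x, h x ^ 2 := Finset.sum_nonneg fun x _ => sq_nonneg _
  have h4 : κ * lam * ∑ x, π x * h x ^ 2 ≤ δ * (lam * ∑ x, h x ^ 2) :=
    calc κ * lam * ∑ x, π x * h x ^ 2 ≤ κ * lam * (M * ∑ x, h x ^ 2) :=
          mul_le_mul_of_nonneg_left h3 (mul_nonneg hκ hlam)
      _ = κ * M * (lam * ∑ x, h x ^ 2) := by ring
      _ ≤ _ := mul_le_mul_of_nonneg_right hκM (mul_nonneg hlam hsq)
  have h5 : δ * (lam * ∑ x, h x ^ 2) ≤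
      δ * (∑ x, h x ^ 2 - ∑ x, Q.mulVec (fun y => h (b.symm y)) x ^ 2) :=
    mul_le_mul_of_nonneg_left (by linarith) hδ
  have h6 := (h4.trans h5).trans h1
  simp only [hPh] at h6
  rw [hexp _ ((sum_mul_mulVec hinv f).trans hf), show ∑ x, π x * h x ^ 2 = _ from hexp f hf] at h6
  have : 0 ≤ κ * lam * a ^ 2 := mul_nonneg (mul_nonneg hκ hlam) (sq_nonneg a)
  linarith

end Transfer

/-! ### Waves as powers of the shifted kernel -/

/-- The change of variables `y ↦ g ^ i y` at time `i` turns the inhomogeneous chain into the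
homogeneous chain with kernel `shiftKernel g K`. -/
theorem chainKernel_waveKernel_apply {V : Type*} [Fintype V] [DecidableEq V] (g : Equiv.Perm V)
    (K : Matrix V V ℝ) (n : ℕ) (x z : V) :
    chainKernel (waveKernel g K) n x z = (shiftKernel g K ^ n) x ((g ^ n) z) := by
  induction n generalizing z with
  | zero => rfl
  | succ n ih =>
    rw [chainKernel, Matrix.mul_apply, pow_succ, Matrix.mul_apply,
      ← Equiv.sum_comp (g ^ n) fun y => (shiftKernel g K ^ n) x y * shiftKernel g K y _]
    refine Finset.sum_congr rfl fun y _ => ?_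
    rw [ih]
    simp [waveKernel, shiftKernel, pow_succ']

/-! ### Merging -/

theorem mainTheorem2 {V : Type*} [Fintype V] [DecidableEq V]
    (Q : Matrix V V ℝ) (hQ : Q ∈ Matrix.rowStochastic ℝ V) (hQsymm : Q.IsSymm)
    (ε : ℝ) (hε : ε ∈ Set.Ioo (0 : ℝ) 1)
    (A : Set V) (Δ : Matrix V V ℝ) (hΔ : IsPerturbation ε A Q Δ)
    (K : Matrix V V ℝ) (hK : K = Q + Δ)
    (g : Equiv.Perm V)
    (p : V → ℝ) (hp : IsInvariantProb (shiftKernel g K) p)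
    (c c₁ C₁ D T : ℝ) (hc : 0 < c) (hc₁ : 0 < c₁) (hC₁ : 0 < C₁) (hD : 0 < D) (hT : 1 < T)
    (hmaxmin : iSup p ≤ c * iInf p)
    (hσ : sigmaOne Q ≤ 1 - c₁ / T)
    (hNash : NashInequality Q C₁ D T)
    (n : ℕ) (hn : 2 * T < (n : ℝ)) (x z : V) :
    |chainKernel (waveKernel g K) n x z / waveMeasure g p n z - 1| ≤
      (16 * (1 + 4 * D) * C₁ * c ^ (2 + 3 / (2 * D)) / (1 - ε) ^ 2) ^ (2 * D) *
        Real.exp (-(c₁ * (1 - ε) ^ 2 * ((n : ℝ) - 2 * T) / (c ^ 2 * T))) := by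
  have : Nonempty V := ⟨x⟩
  obtain ⟨hε0, hε1⟩ := hε
  have hη : 0 < 1 - ε := by linarith
  have hη1 : 1 - ε ≤ 1 := by linarith
  have hT0 : 0 < T := by linarith
  have hθ : 0 < 1 / (2 * D) := by positivity
  have hQrow : ∀ x, ∑ y, Q x y = 1 := Matrix.sum_row_of_mem_rowStochastic hQ
  have hQcol : ∀ y, ∑ x, Q x y = 1 := fun y => by
    rw [← hQrow y]; exact Finset.sum_congr rfl fun x _ => hQsymm.apply y x
  have hQ0 : ∀ x y, 0 ≤ Q x y := fun _ _ => Matrix.nonneg_of_mem_rowStochastic hQ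
  -- the invariant measure is positive and almost uniform
  obtain ⟨m, hm⟩ : ∃ m, m = iInf p := ⟨_, rfl⟩
  rw [← hm] at hmaxmin
  have hlow : ∀ y, m ≤ p y := fun y => hm ▸ ciInf_le (Set.finite_range p).bddBelow y
  have hup : ∀ y, p y ≤ c * m := fun y => (le_ciSup (Set.finite_range p).bddAbove y).trans hmaxmin
  have hm0 : 0 < m := by
    by_contra hneg
    have : ∑ y, p y ≤ 0 := Finset.sum_nonpos fun y _ =>
      (hup y).trans (mul_nonpos_of_nonneg_of_nonpos hc.le (not_lt.1 hneg))
    rw [hp.sum_eq_one] at this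
    linarith
  have hpos : ∀ y, 0 < p y := fun y => hm0.trans_le (hlow y)
  have hc1 : 1 ≤ c := by
    by_contra hlt
    have h1 := (hlow x).trans (hup x)
    nlinarith
  -- the shifted kernel and its time reversal dominate rearrangements of `Q`
  set P := shiftKernel g K with hP
  have hPlow : ∀ y w, (1 - ε) * Q y (g⁻¹ w) ≤ P y w := fun y w => by
    have := hΔ.lower y (g⁻¹ w)
    simp only [hP, shiftKernel, hK, Matrix.add_apply]
    linarith
  have hP0 : ∀ y w, 0 ≤ P y w := fun y w => (mul_nonneg hη.le (hQ0 _ _)).trans (hPlow y w)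
  have hProw : ∀ y, ∑ w, P y w = 1 := fun y => by
    simp only [hP, shiftKernel]
    rw [Equiv.sum_comp g⁻¹ fun w => K y w, hK]
    simp [Finset.sum_add_distrib, hQrow, hΔ.sum_eq_zero]
  have hPinv := hp.invariant
  set R := timeReversal p P with hR
  have hpR : ∀ y w, p y * R y w = p w * P w y := fun y w => by
    simp only [hR, timeReversal]
    rw [mul_div_cancel₀ _ (hpos y).ne']
  have hR0 : ∀ y w, 0 ≤ R y w := fun y w =>
    div_nonneg (mul_nonneg (hpos w).le (hP0 w y)) (hpos y).le
  have hRrow : ∀ y, ∑ w, R y w = 1 := fun y => by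
    simp only [hR, timeReversal, ← Finset.sum_div, hPinv, div_self (hpos y).ne']
  have hRinv : ∀ w, ∑ y, p y * R y w = p w := fun w => by
    simp only [hpR, ← Finset.mul_sum, hProw, mul_one]
  have hδ : 0 ≤ m * (1 - ε) := by positivity
  have hmul : ∀ y w, m * (1 - ε) * Q y (g⁻¹ w) ≤ p y * P y w := fun y w => by
    rw [mul_assoc]
    exact mul_le_mul (hlow y) (hPlow y w) (mul_nonneg hη.le (hQ0 _ _)) (hpos y).le
  have hcmpP := dirichlet_comparison hδ hProw hPinv hQrow hQcol 1 g⁻¹ hmul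
  have hcmpR := dirichlet_comparison hδ hRrow hRinv hQrow hQcol g⁻¹ 1 fun y w => by
    rw [hpR, hQsymm.apply]
    exact hmul w y
  have hNashP := nash_transfer hNash hC₁ hD hT0 hc hη hη1 hm0 hlow hup hp.sum_eq_one hP0 hProw
    hPinv g⁻¹ hcmpP
  have hNashR := nash_transfer hNash hC₁ hD hT0 hc hη hη1 hm0 hlow hup hp.sum_eq_one hR0 hRrow
    hRinv 1 hcmpR
  -- `N` steps for each of the two Nash phases
  set N := ⌊T⌋₊ with hNdef
  have hN1 : 1 ≤ N := Nat.le_floor (by exact_mod_cast hT.le)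
  have hN1' : (1 : ℝ) ≤ N := by exact_mod_cast hN1
  have hNT : (N : ℝ) ≤ T := Nat.floor_le hT0.le
  have hTN : T ≤ 2 * N := by linarith [Nat.lt_floor_add_one T]
  set C := C₁ * T * c ^ (1 + 2 * (1 / (2 * D))) / (1 - ε) with hC
  have hC0 : 0 < C := by positivity
  set B := (16 * (1 + 4 * D) * C₁ * c ^ (2 + 3 / (2 * D)) / (1 - ε) ^ 2) with hB
  have hB0 : 0 < B := by positivity
  have hCB : max (2 * C / T) (2 * C / (N * (1 / (2 * D)))) ≤ B := by
    have h1 : 2 * C / T ≤ 2 * (1 + 4 * D) * C / T := by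
      refine div_le_div_of_nonneg_right ?_ hT0.le
      nlinarith [mul_pos hD hC0]
    have h2 : 2 * C / (N * (1 / (2 * D))) ≤ 2 * (1 + 4 * D) * C / T := by
      rw [show 2 * C / (N * (1 / (2 * D))) = 4 * D * C / N by field_simp; ring,
        div_le_div_iff₀ (by linarith) hT0]
      have h3 : 4 * D * C * T ≤ 4 * D * C * (2 * N) := mul_le_mul_of_nonneg_left hTN (by positivity)
      have h4 : 0 ≤ C * N := by positivity
      nlinarith
    refine (max_le h1 h2).trans ?_
    have h5 : c ^ (1 + 2 * (1 / (2 * D))) ≤ c ^ (2 + 3 / (2 * D)) := by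
      refine Real.rpow_le_rpow_of_exponent_le hc1 ?_
      rw [show 3 / (2 * D) = 3 * (1 / (2 * D)) by ring]
      linarith
    have h6 : (1 - ε) ^ 2 ≤ 1 - ε := by nlinarith
    calc 2 * (1 + 4 * D) * C / T
        = 2 * (1 + 4 * D) * C₁ * c ^ (1 + 2 * (1 / (2 * D))) / (1 - ε) := by
          rw [hC]; field_simp
      _ ≤ B := by
          refine div_le_div₀ (by positivity) ?_ (by positivity) h6
          refine mul_le_mul ?_ h5 (by positivity) (by positivity)
          have : 0 < (1 + 4 * D) * C₁ := by positivity
          nlinarith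
  have hroot : ∀ t : ℝ, 0 ≤ t → t ^ (1 / (2 * D)) ≤ B → t ≤ B ^ (2 * D) := fun t ht h => by
    have h1 := Real.rpow_le_rpow (Real.rpow_nonneg ht _) h (by positivity : 0 ≤ 2 * D)
    rwa [← Real.rpow_mul ht, one_div_mul_cancel (by positivity), Real.rpow_one] at h1
  have hsq0 : ∀ f : V → ℝ, 0 ≤ ∑ y, p y * f y ^ 2 := fun f =>
    Finset.sum_nonneg fun y _ => mul_nonneg (hpos y).le (sq_nonneg _)
  have hfwd : ∀ f : V → ℝ, ∑ y, p y * |f y| ≤ 1 →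
      ∑ y, p y * (P ^ N).mulVec f y ^ 2 ≤ B ^ (2 * D) := fun f hf =>
    hroot _ (hsq0 _) ((sum_mul_pow_mulVec_sq_rpow_le (fun y => (hpos y).le) hP0 hProw hPinv hC0
      hT0 hθ hNashP hf hN1).trans hCB)
  have hbwd : ∀ f : V → ℝ, ∑ y, p y * |f y| ≤ 1 →
      ∑ y, p y * (R ^ N).mulVec f y ^ 2 ≤ B ^ (2 * D) := fun f hf =>
    hroot _ (hsq0 _) ((sum_mul_pow_mulVec_sq_rpow_le (fun y => (hpos y).le) hR0 hRrow hRinv hC0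
      hT0 hθ hNashR hf hN1).trans hCB)
  -- the spectral gap, for the remaining steps
  set s := c₁ / T with hs
  set κ := (1 - ε) / c with hκ
  have hs0 : 0 < s := by positivity
  have hs1 : s ≤ 1 := by
    have : 0 ≤ sigmaOne Q := (UniformL2.op Q).singularValues_nonneg 1
    linarith
  have hκ0 : 0 ≤ κ := by positivity
  have hκ1 : κ ≤ 1 := (div_le_one hc).2 (by linarith)
  have hgap : ∀ f : V → ℝ, ∑ y, p y * f y = 0 →
      ∑ y, p y * P.mulVec f y ^ 2 ≤ Real.exp (-(κ ^ 2 * s)) ^ 2 * ∑ y, p y * f y ^ 2 := by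
    intro f hf
    have hQgap : ∀ f : V → ℝ, ∑ y, f y = 0 →
        ∑ y, Q.mulVec f y ^ 2 ≤ (1 - (1 - (1 - s) ^ 2)) * ∑ y, f y ^ 2 := fun f hf => by
      rw [sub_sub_cancel]
      exact sum_mulVec_sq_le_of_sigmaOne_lt_one hQ hQsymm hσ (by linarith) hf
    refine (gap_transfer hQgap (by nlinarith) hδ hκ0 (M := c * m) (le_of_eq ?_) hup hp.sum_eq_one
      hProw hPinv g⁻¹ hcmpP hf).trans ?_
    · rw [hκ]; field_simp
    · refine mul_le_mul_of_nonneg_right ?_ (hsq0 f)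
      refine (one_sub_mul_le_exp hκ0 hκ1 hs0.le hs1).trans_eq ?_
      rw [← Real.exp_nat_mul]; congr 1; push_cast; ring
  have h2N : 2 * N ≤ n := by
    have : (2 * N : ℝ) ≤ n := by linarith
    exact_mod_cast this
  have hsplit : n = N + (n - 2 * N) + N := by omega
  have hfin := abs_pow_div_sub_one_le hpos hp.sum_eq_one hProw hPinv (Real.exp_pos _).le hgap hfwd
    hbwd (m := n - 2 * N) x ((g ^ n) z)
  rw [← hsplit] at hfin
  rw [chainKernel_waveKernel_apply, waveMeasure]
  refine hfin.trans (mul_le_mul_of_nonneg_left ?_ (by positivity))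
  rw [← Real.exp_nat_mul, Real.exp_le_exp, Nat.cast_sub h2N]
  push_cast
  have hlen : κ ^ 2 * s * (n - 2 * T) ≤ κ ^ 2 * s * (n - 2 * N) :=
    mul_le_mul_of_nonneg_left (by linarith) (by positivity)
  have hrate : c₁ * (1 - ε) ^ 2 * ((n : ℝ) - 2 * T) / (c ^ 2 * T) = κ ^ 2 * s * (n - 2 * T) := by
    rw [hκ, hs]; field_simp
  rw [hrate]
  linarith
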